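/- Let $k$ be a field and let $C$ be a $k$-coalgebra with comultiplication $\Delta$ that is almost connected, i.e. its coradical $C_0$ (the sum of all simple subcoalgebras of $C$) is finite-dimensional over $k$. Let $M$ be a right $C$-comodule with coaction $\rho(m)=\sum m_0\otimes m_1$. A right $C$-comodule $N$ is called quasi-finite if $\mathrm{Hom}_C(S,N)$ is a finite-dimensional $k$-vector space for every simple right $C$-comodule $S$. The dual algebra $C^*=\mathrm{Hom}_k(C,k)$ carries the convolution product $(f*g)(c)=\sum f(c_1)g(c_2)$, where $\Delta(c)=\sum c_1\otimes c_2$, and $M^*=\mathrm{Hom}_k(M,k)$ is a right $C^*$-module via $(\varphi\cdot f)(m)=\sum\varphi(m_0)f(m_1)$. Then the following statements are equivalent: (i) $M$ is strictly quasi-finite, i.e. $M/M'$ is quasi-finite for every subcomodule $M'$ of $M$; (ii) $M$ is co-noetherian, i.e. for every subcomodule $M'$ of $M$ the comodule $M/M'$ embeds in a finite direct sum of copies of the right $C$-comodule $C$; (iii) $M^*$ is a noetherian right $C^*$-module; (iv) $M$ is an artinian comodule, i.e. $M$ satisfies the descending chain condition on subcomodules. -/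

import Mathlib

open scoped TensorProduct

/-- A right comodule over a `k`-coalgebra `C`: a `k`-module `M` with a coaction
`ρ : M → M ⊗ C` such that `(ρ ⊗ id) ∘ ρ = (id ⊗ Δ) ∘ ρ` (up to the associator) and
`(id ⊗ ε) ∘ ρ = id` (under `M ⊗ k ≅ M`). -/
class RightComodule (k C M : Type*) [CommRing k] [AddCommGroup C] [Module k C] [Coalgebra k C]
    [AddCommGroup M] [Module k M] where
  /-- The coaction. -/
  coact : M →ₗ[k] M ⊗[k] C
  coassoc : (TensorProduct.assoc k M C C).toLinearMap ∘ₗ coact.rTensor C ∘ₗ coact =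
    (Coalgebra.comul (R := k) (A := C)).lTensor M ∘ₗ coact
  counit_coact : (TensorProduct.rid k M).toLinearMap ∘ₗ
    (Coalgebra.counit (R := k) (A := C)).lTensor M ∘ₗ coact = LinearMap.id

namespace RightComodule

section Basic

variable {k C M N : Type*} [CommRing k] [AddCommGroup C] [Module k C] [Coalgebra k C]
  [AddCommGroup M] [Module k M] [AddCommGroup N] [Module k N]

theorem coassoc_comp_of_comm [RightComodule k C M] (r : N →ₗ[k] N ⊗[k] C) (g : M →ₗ[k] N)
    (h : r ∘ₗ g = g.rTensor C ∘ₗ coact) :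
    ((TensorProduct.assoc k N C C).toLinearMap ∘ₗ r.rTensor C ∘ₗ r) ∘ₗ g =
      ((Coalgebra.comul (R := k) (A := C)).lTensor N ∘ₗ r) ∘ₗ g := by
  have e1 : (TensorProduct.assoc k N C C).toLinearMap ∘ₗ (g.rTensor C).rTensor C =
      g.rTensor (C ⊗[k] C) ∘ₗ (TensorProduct.assoc k M C C).toLinearMap := by
    ext; simp
  have e2 : (Coalgebra.comul (R := k) (A := C)).lTensor N ∘ₗ g.rTensor C =
      g.rTensor (C ⊗[k] C) ∘ₗ (Coalgebra.comul (R := k) (A := C)).lTensor M := by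
    ext; simp
  calc _ = ((TensorProduct.assoc k N C C).toLinearMap ∘ₗ (g.rTensor C).rTensor C) ∘ₗ
        coact.rTensor C ∘ₗ coact := by
        rw [LinearMap.comp_assoc, LinearMap.comp_assoc, h, LinearMap.comp_assoc,
          ← LinearMap.comp_assoc _ (g.rTensor C) (r.rTensor C), ← LinearMap.rTensor_comp, h,
          LinearMap.rTensor_comp, LinearMap.comp_assoc]
    _ = ((Coalgebra.comul (R := k) (A := C)).lTensor N ∘ₗ r) ∘ₗ g := by
        rw [e1, LinearMap.comp_assoc, coassoc, LinearMap.comp_assoc, h, ← LinearMap.comp_assoc,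
          ← LinearMap.comp_assoc, e2]

theorem counit_comp_of_comm [RightComodule k C M] (r : N →ₗ[k] N ⊗[k] C) (g : M →ₗ[k] N)
    (h : r ∘ₗ g = g.rTensor C ∘ₗ coact) :
    ((TensorProduct.rid k N).toLinearMap ∘ₗ
      (Coalgebra.counit (R := k) (A := C)).lTensor N ∘ₗ r) ∘ₗ g = g := by
  have e : (TensorProduct.rid k N).toLinearMap ∘ₗ
      (Coalgebra.counit (R := k) (A := C)).lTensor N ∘ₗ g.rTensor C =
      g ∘ₗ (TensorProduct.rid k M).toLinearMap ∘ₗ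
        (Coalgebra.counit (R := k) (A := C)).lTensor M := by
    ext; simp
  rw [LinearMap.comp_assoc, LinearMap.comp_assoc, h, ← LinearMap.comp_assoc coact,
    ← LinearMap.comp_assoc coact, e, LinearMap.comp_assoc, LinearMap.comp_assoc, counit_coact,
    LinearMap.comp_id]

/-- The coalgebra `C` as a right comodule over itself, with coaction `Δ`. -/
instance regular : RightComodule k C C where
  coact := Coalgebra.comul
  coassoc := Coalgebra.coassoc
  counit_coact := by
    rw [Coalgebra.lTensor_counit_comp_comul]
    ext; simp

/-- The coaction of a finite direct sum of copies of a comodule, `Mⁿ`. -/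
def piCoact (k C M : Type*) [CommRing k] [AddCommGroup C] [Module k C] [Coalgebra k C]
    [AddCommGroup M] [Module k M] [RightComodule k C M] (n : ℕ) :
    (Fin n → M) →ₗ[k] (Fin n → M) ⊗[k] C :=
  ∑ i, (LinearMap.single k (fun _ : Fin n => M) i).rTensor C ∘ₗ coact ∘ₗ LinearMap.proj i

theorem piCoact_comp_single [RightComodule k C M] (n : ℕ) (i : Fin n) :
    piCoact k C M n ∘ₗ LinearMap.single k (fun _ => M) i =
      (LinearMap.single k (fun _ : Fin n => M) i).rTensor C ∘ₗ coact := by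
  ext m
  simp only [piCoact, LinearMap.comp_apply, LinearMap.sum_apply, LinearMap.proj_apply,
    LinearMap.single_apply]
  rw [Finset.sum_eq_single i]
  · simp
  · intro j _ hj
    simp [Pi.single_eq_of_ne hj]
  · simp

/-- The finite direct sum of `n` copies of a comodule. -/
instance pi (n : ℕ) [RightComodule k C M] : RightComodule k C (Fin n → M) where
  coact := piCoact k C M n
  coassoc := LinearMap.pi_ext' fun i => coassoc_comp_of_comm _ _ (piCoact_comp_single n i)
  counit_coact := LinearMap.pi_ext' fun i => by
    rw [counit_comp_of_comm _ _ (piCoact_comp_single n i), LinearMap.id_comp]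

end Basic

section Field

variable (k C M N : Type*) [Field k] [AddCommGroup C] [Module k C] [Coalgebra k C]
  [AddCommGroup M] [Module k M] [RightComodule k C M]
  [AddCommGroup N] [Module k N] [RightComodule k C N]

/-- A subcomodule of `M`: a subspace `X` with `ρ(X) ⊆ X ⊗ C`, where `X ⊗ C` is regarded as a
subspace of `M ⊗ C`. -/
@[ext]
structure Subcomodule where
  /-- The underlying subspace. -/
  carrier : Submodule k M
  coact_mem : ∀ x ∈ carrier,
    (coact x : M ⊗[k] C) ∈ LinearMap.range (carrier.subtype.rTensor C)

/-- Subcomodules are ordered by inclusion. -/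
instance : PartialOrder (Subcomodule k C M) :=
  PartialOrder.lift Subcomodule.carrier fun _ _ => Subcomodule.ext

variable {k C M} in
theorem Subcomodule.le_ker (X : Subcomodule k C M) :
    X.carrier ≤ LinearMap.ker (X.carrier.mkQ.rTensor C ∘ₗ coact) := by
  intro x hx
  obtain ⟨y, hy⟩ := X.coact_mem x hx
  rw [LinearMap.mem_ker, LinearMap.comp_apply, ← hy, ← LinearMap.comp_apply,
    ← LinearMap.rTensor_comp]
  have : X.carrier.mkQ ∘ₗ X.carrier.subtype = 0 := by ext; simp
  rw [this, LinearMap.rTensor_zero, LinearMap.zero_apply]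

/-- The factor comodule `M / X`. -/
instance quotient (X : Subcomodule k C M) : RightComodule k C (M ⧸ X.carrier) where
  coact := X.carrier.liftQ (X.carrier.mkQ.rTensor C ∘ₗ coact) X.le_ker
  coassoc := Submodule.linearMap_qext _ <|
    coassoc_comp_of_comm _ _ (Submodule.liftQ_mkQ _ _ X.le_ker)
  counit_coact := Submodule.linearMap_qext _ <| by
    rw [counit_comp_of_comm _ _ (Submodule.liftQ_mkQ _ _ X.le_ker), LinearMap.id_comp]

/-- The space of comodule homomorphisms `M → N`, as a subspace of the linear maps. -/
def comoduleHom : Submodule k (M →ₗ[k] N) where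
  carrier := {f | (coact ∘ₗ f : M →ₗ[k] N ⊗[k] C) = f.rTensor C ∘ₗ coact}
  add_mem' {f g} hf hg := by
    simp only [Set.mem_ofPred_eq] at *
    rw [LinearMap.comp_add, hf, hg, LinearMap.rTensor_add, LinearMap.add_comp]
  zero_mem' := by simp
  smul_mem' c f hf := by
    simp only [Set.mem_ofPred_eq] at *
    rw [LinearMap.comp_smul, hf, LinearMap.rTensor_smul, LinearMap.smul_comp]

/-- A simple comodule: nonzero, with no subcomodules other than zero and the whole comodule. -/
def IsSimple : Prop :=
  Nontrivial M ∧ ∀ X : Subcomodule k C M, X.carrier = ⊥ ∨ X.carrier = ⊤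

end Field

section Finiteness

universe u v w

variable (k : Type u) (C : Type v) (M : Type w) [Field k] [AddCommGroup C] [Module k C]
  [Coalgebra k C] [AddCommGroup M] [Module k M] [RightComodule k C M]

/-- `M` is quasi-finite: `Hom(S, M)` is finite-dimensional for every simple right comodule `S`.
Letting `S` range over the universe of `M` loses nothing, since `Hom(S, M) ≠ 0` forces a simple
`S` to be isomorphic to a subcomodule of `M`. -/
def IsQuasiFinite : Prop :=
  ∀ (S : Type w) [AddCommGroup S] [Module k S] [RightComodule k C S],
    IsSimple k C S → FiniteDimensional k (comoduleHom k C S M)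

/-- `M` is strictly quasi-finite: every factor comodule of `M` is quasi-finite. -/
def IsStrictlyQuasiFinite : Prop :=
  ∀ X : Subcomodule k C M, IsQuasiFinite k C (M ⧸ X.carrier)

/-- `M` is co-noetherian: every factor comodule of `M` embeds in some `Cⁿ`. -/
def IsCoNoetherian : Prop :=
  ∀ X : Subcomodule k C M, ∃ (n : ℕ) (f : (M ⧸ X.carrier) →ₗ[k] (Fin n → C)),
    f ∈ comoduleHom k C (M ⧸ X.carrier) (Fin n → C) ∧ Function.Injective f

/-- `M` is an artinian comodule: descending chain condition on subcomodules. -/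
def IsArtinianComodule : Prop := WellFoundedLT (Subcomodule k C M)

end Finiteness

section Dual

variable (k C M : Type*) [Field k] [AddCommGroup C] [Module k C] [Coalgebra k C]
  [AddCommGroup M] [Module k M] [RightComodule k C M]

/-- The dual algebra `C*`, with the convolution product `(f * g)(c) = ∑ f(c₁) g(c₂)`. -/
abbrev DualAlgebra : Type _ := WithConv (C →ₗ[k] k)

/-- The right action of `C*` on `M*`: `(φ · f)(m) = ∑ φ(m₀) f(m₁)`, where `ρ(m) = ∑ m₀ ⊗ m₁`. -/
noncomputable def dualAct {k C M : Type*} [Field k] [AddCommGroup C] [Module k C] [Coalgebra k C]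
    [AddCommGroup M] [Module k M] [RightComodule k C M]
    (φ : Module.Dual k M) (f : DualAlgebra k C) : Module.Dual k M :=
  LinearMap.mul' k k ∘ₗ TensorProduct.map φ f.ofConv ∘ₗ coact

variable {k C M} in
theorem dualAct_one (φ : Module.Dual k M) : dualAct φ (1 : DualAlgebra k C) = φ := by
  have e : LinearMap.mul' k k ∘ₗ TensorProduct.map φ (1 : DualAlgebra k C).ofConv =
      φ ∘ₗ (TensorProduct.rid k M).toLinearMap ∘ₗ
        (Coalgebra.counit (R := k) (A := C)).lTensor M := by
    ext m c
    simp [mul_comm, LinearMap.convOne_def]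
  rw [dualAct, ← LinearMap.comp_assoc, e, LinearMap.comp_assoc, LinearMap.comp_assoc,
    counit_coact, LinearMap.comp_id]

variable {k C M} in
theorem dualAct_mul (φ : Module.Dual k M) (f g : DualAlgebra k C) :
    dualAct φ (f * g) = dualAct (dualAct φ f) g := by
  have e1 : LinearMap.mul' k k ∘ₗ TensorProduct.map φ (f * g).ofConv =
      (LinearMap.mul' k k ∘ₗ
        TensorProduct.map φ (LinearMap.mul' k k ∘ₗ TensorProduct.map f.ofConv g.ofConv)) ∘ₗ
        (Coalgebra.comul (R := k) (A := C)).lTensor M := by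
    ext m c
    simp [LinearMap.convMul_def]
  have e2 : LinearMap.mul' k k ∘ₗ TensorProduct.map (dualAct φ f) g.ofConv =
      (LinearMap.mul' k k ∘ₗ TensorProduct.map
        (LinearMap.mul' k k ∘ₗ TensorProduct.map φ f.ofConv) g.ofConv) ∘ₗ
        (coact : M →ₗ[k] M ⊗[k] C).rTensor C := by
    ext m c
    simp [dualAct]
  have e3 : (LinearMap.mul' k k ∘ₗ TensorProduct.map φ
        (LinearMap.mul' k k ∘ₗ TensorProduct.map f.ofConv g.ofConv)) ∘ₗ
        (TensorProduct.assoc k M C C).toLinearMap =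
      LinearMap.mul' k k ∘ₗ TensorProduct.map
        (LinearMap.mul' k k ∘ₗ TensorProduct.map φ f.ofConv) g.ofConv := by
    ext m c d
    simp [mul_assoc]
  rw [dualAct, ← LinearMap.comp_assoc, e1, LinearMap.comp_assoc, ← coassoc,
    ← LinearMap.comp_assoc, e3, ← LinearMap.comp_assoc, ← e2, LinearMap.comp_assoc, ← dualAct]

/-- `M*` as a right `C*`-module, i.e. as a module over the opposite algebra of `C*`. -/
noncomputable instance dualModule : Module (DualAlgebra k C)ᵐᵒᵖ (Module.Dual k M) where
  smul f φ := dualAct φ f.unop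
  one_smul φ := dualAct_one φ
  mul_smul f g φ := dualAct_mul φ g.unop f.unop
  smul_zero f := by
    change dualAct 0 f.unop = 0
    simp [dualAct]
  smul_add f φ ψ := by
    change dualAct (φ + ψ) f.unop = dualAct φ f.unop + dualAct ψ f.unop
    simp [dualAct, TensorProduct.map_add_left, LinearMap.add_comp, LinearMap.comp_add]
  add_smul f g φ := by
    change dualAct φ (f + g).unop = dualAct φ f.unop + dualAct φ g.unop
    simp [dualAct, TensorProduct.map_add_right, LinearMap.add_comp, LinearMap.comp_add]
  zero_smul φ := by
    change dualAct φ (0 : (DualAlgebra k C)ᵐᵒᵖ).unop = 0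
    simp [dualAct]

end Dual

end RightComodule

section Coradical

variable (k : Type*) {C : Type*} [Field k] [AddCommGroup C] [Module k C] [Coalgebra k C]

/-- A subcoalgebra of `C`: a subspace `D` with `Δ(D) ⊆ D ⊗ D`, where `D ⊗ D` is regarded as a
subspace of `C ⊗ C`. -/
def IsSubcoalgebra (D : Submodule k C) : Prop :=
  ∀ x ∈ D, (Coalgebra.comul x : C ⊗[k] C) ∈
    LinearMap.range (TensorProduct.map D.subtype D.subtype)

/-- A simple subcoalgebra: nonzero, and containing no subcoalgebras but zero and itself. -/
def IsSimpleSubcoalgebra (D : Submodule k C) : Prop :=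
  IsSubcoalgebra k D ∧ D ≠ ⊥ ∧ ∀ E ≤ D, IsSubcoalgebra k E → E = ⊥ ∨ E = D

variable (C) in
/-- The coradical `C₀`: the sum of all simple subcoalgebras of `C`. -/
def coradical : Submodule k C := sSup {D | IsSimpleSubcoalgebra k D}

variable (C) in
/-- `C` is almost connected if its coradical is finite-dimensional. -/
def IsAlmostConnected : Prop := FiniteDimensional k (coradical k C)

end Coradical

/-! Contracting the coaction with functionals makes a right comodule a left `C*`-module, `f • m = ∑
f(m₁) m₀`. Over a field, subcomodules are exactly `C*`-submodules and comodule maps are the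
`C*`-linear maps. Such modules are locally finite, so simple comodules are finite-dimensional and
every nonzero submodule contains a simple one. The equivalence is proved as the cycle (i) ⇒ (iv) ⇒
(iii) ⇒ (ii) ⇒ (i); only (i) ⇒ (iv) uses almost connectedness.

(i) ⇒ (iv): dividing by the intersection of a descending chain reduces to zero intersection. For
each simple `S`, the maps from `S` into the terms form a descending chain in the finite-dimensional
`Hom(S, N)`, so they vanish eventually. Simple comodules embed in the finite-dimensional coradical,
hence have finitely many isomorphism types, and one stage serves them all. That term contains no
simple submodule, so it is zero.

(iv) ⇒ (iii) and (iii) ⇒ (ii) rest on the coefficient maps `m ↦ ∑ φ(m₀) m₁` from `M` to `C`. For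
generators `φᵢ` of a submodule of `M*`, they combine into a map `M → Cⁿ` whose kernel is the
orthogonal of that submodule (`mem_orthogonal_span_range_iff`). It follows that finitely generated
submodules of `M*` equal their double annihilators.

(ii) ⇒ (i): a comodule map into `C` is determined by its composite with the counit, so `Hom(S, Cⁿ)`
embeds in `(S*)ⁿ`. -/

namespace RightComodule

/-! ### Contractions of tensors by functionals -/

section Slices

variable {k C M N : Type*} [Field k] [AddCommGroup C] [Module k C]
  [AddCommGroup M] [Module k M] [AddCommGroup N] [Module k N]

/-- The contraction `m ⊗ c ↦ f(c) m`. -/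
noncomputable def sliceRight (M : Type*) [AddCommGroup M] [Module k M] (f : C →ₗ[k] k) :
    M ⊗[k] C →ₗ[k] M :=
  (TensorProduct.rid k M).toLinearMap ∘ₗ f.lTensor M

/-- The contraction `m ⊗ c ↦ φ(m) c`. -/
noncomputable def sliceLeft (C : Type*) [AddCommGroup C] [Module k C] (φ : M →ₗ[k] k) :
    M ⊗[k] C →ₗ[k] C :=
  (TensorProduct.lid k C).toLinearMap ∘ₗ φ.rTensor C

@[simp]
theorem sliceRight_tmul (f : C →ₗ[k] k) (m : M) (c : C) : sliceRight M f (m ⊗ₜ c) = f c • m := by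
  simp [sliceRight]

@[simp]
theorem sliceLeft_tmul (φ : M →ₗ[k] k) (m : M) (c : C) : sliceLeft C φ (m ⊗ₜ c) = φ m • c := by
  simp [sliceLeft]

theorem sliceRight_rTensor (f : C →ₗ[k] k) (g : M →ₗ[k] N) (x : M ⊗[k] C) :
    sliceRight N f (g.rTensor C x) = g (sliceRight M f x) := by
  induction x with
  | zero => simp
  | add x y hx hy => simp only [map_add, hx, hy]
  | tmul m c => simp

theorem sliceLeft_lTensor (φ : M →ₗ[k] k) (g : C →ₗ[k] N) (x : M ⊗[k] C) :
    sliceLeft N φ (g.lTensor M x) = g (sliceLeft C φ x) := by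
  induction x with
  | zero => simp
  | add x y hx hy => simp only [map_add, hx, hy]
  | tmul m c => simp

theorem apply_sliceLeft (φ : M →ₗ[k] k) (f : C →ₗ[k] k) (x : M ⊗[k] C) :
    f (sliceLeft C φ x) = φ (sliceRight M f x) := by
  induction x with
  | zero => simp
  | add x y hx hy => simp only [map_add, hx, hy]
  | tmul m c => simp [mul_comm]

theorem eq_of_forall_dual {x y : M} (h : ∀ φ : Module.Dual k M, φ x = φ y) : x = y :=
  sub_eq_zero.mp <| (Module.forall_dual_apply_eq_zero_iff k _).mp fun φ => by
    rw [map_sub, h, sub_self]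

/-- Contractions with the coordinate functionals of a basis of `C` are the coordinates of a tensor
in `M ⊗ C`. -/
theorem eq_of_sliceRight {x y : M ⊗[k] C}
    (h : ∀ f : C →ₗ[k] k, sliceRight M f x = sliceRight M f y) : x = y := by
  classical
  let b := Module.Basis.ofVectorSpace k C
  apply (TensorProduct.equivFinsuppOfBasisRight (M := M) b).injective
  ext i
  have key : ∀ z : M ⊗[k] C,
      TensorProduct.equivFinsuppOfBasisRight b z i = sliceRight M (b.coord i) z := by
    intro z
    induction z with
    | zero => simp
    | add x y hx hy => simp only [map_add, Finsupp.add_apply, hx, hy]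
    | tmul m c => simp
  rw [key, key, h]

theorem eq_of_sliceLeft {x y : M ⊗[k] C}
    (h : ∀ φ : M →ₗ[k] k, sliceLeft C φ x = sliceLeft C φ y) : x = y :=
  eq_of_sliceRight fun f => eq_of_forall_dual (k := k) fun φ => by
    rw [← apply_sliceLeft, ← apply_sliceLeft, h]

/-- A tensor whose right slices all lie in `X` lies in `X ⊗ C`. -/
theorem rTensor_comp_eq_self {X : Submodule k M} (p : M →ₗ[k] M) (hp : ∀ m ∈ X, p m = m)
    {x : M ⊗[k] C} (h : ∀ f : C →ₗ[k] k, sliceRight M f x ∈ X) : p.rTensor C x = x :=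
  eq_of_sliceRight fun f => by rw [sliceRight_rTensor, hp _ (h f)]

theorem lTensor_comp_eq_self {X : Submodule k C} (p : C →ₗ[k] C) (hp : ∀ m ∈ X, p m = m)
    {x : M ⊗[k] C} (h : ∀ φ : M →ₗ[k] k, sliceLeft C φ x ∈ X) : p.lTensor M x = x :=
  eq_of_sliceLeft fun f => by rw [sliceLeft_lTensor, hp _ (h f)]

theorem exists_retraction (X : Submodule k M) : ∃ p : M →ₗ[k] X, ∀ x : X, p x = x := by
  obtain ⟨p, hp⟩ := X.subtype.exists_leftInverse_of_injective X.ker_subtype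
  exact ⟨p, fun x => LinearMap.congr_fun hp x⟩

/-- A retraction of `M` onto `X` fixes every slice, hence fixes the tensor itself. This turns the
subcomodule condition into stability under `C*`. -/
theorem mem_range_rTensor_subtype_iff {X : Submodule k M} {x : M ⊗[k] C} :
    x ∈ LinearMap.range (X.subtype.rTensor C) ↔ ∀ f : C →ₗ[k] k, sliceRight M f x ∈ X := by
  constructor
  · rintro ⟨y, rfl⟩ f
    rw [sliceRight_rTensor]
    exact (sliceRight X f y).2
  · intro h
    obtain ⟨p, hp⟩ := exists_retraction X
    refine ⟨p.rTensor C x, ?_⟩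
    rw [← LinearMap.comp_apply, ← LinearMap.rTensor_comp]
    exact rTensor_comp_eq_self _ (fun m hm => congrArg Subtype.val (hp ⟨m, hm⟩)) h

theorem mem_range_map_subtype_iff {X : Submodule k M} {Y : Submodule k C} {x : M ⊗[k] C} :
    x ∈ LinearMap.range (TensorProduct.map X.subtype Y.subtype) ↔
      (∀ f : C →ₗ[k] k, sliceRight M f x ∈ X) ∧ ∀ φ : M →ₗ[k] k, sliceLeft C φ x ∈ Y := by
  constructor
  · rintro ⟨y, rfl⟩
    induction y with
    | zero => simp
    | add x y hx hy =>
      simp only [map_add]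
      exact ⟨fun f => add_mem (hx.1 f) (hy.1 f), fun f => add_mem (hx.2 f) (hy.2 f)⟩
    | tmul m c =>
      simp only [TensorProduct.map_tmul, sliceRight_tmul, sliceLeft_tmul]
      exact ⟨fun f => X.smul_mem _ m.2, fun f => Y.smul_mem _ c.2⟩
  · rintro ⟨h1, h2⟩
    obtain ⟨p, hp⟩ := exists_retraction X
    obtain ⟨q, hq⟩ := exists_retraction Y
    refine ⟨TensorProduct.map p q x, ?_⟩
    rw [← LinearMap.comp_apply, ← TensorProduct.map_comp, ← LinearMap.rTensor_comp_lTensor,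
      LinearMap.comp_apply,
      lTensor_comp_eq_self _ (fun m hm => congrArg Subtype.val (hq ⟨m, hm⟩)) h2,
      rTensor_comp_eq_self _ (fun m hm => congrArg Subtype.val (hp ⟨m, hm⟩)) h1]

end Slices

/-! ### The `C*`-module structure and coefficient maps -/

section Action

variable {k C M N : Type*} [Field k] [AddCommGroup C] [Module k C] [Coalgebra k C]
  [AddCommGroup M] [Module k M] [RightComodule k C M]
  [AddCommGroup N] [Module k N] [RightComodule k C N]

/-- The left action of `C*` on a right comodule: `f · m = ∑ f(m₁) m₀`. -/
noncomputable def act (f : DualAlgebra k C) (m : M) : M := sliceRight M f.ofConv (coact m)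

theorem apply_act (φ : Module.Dual k M) (f : DualAlgebra k C) (m : M) :
    φ (act f m) = dualAct φ f m := by
  have : ∀ x : M ⊗[k] C, φ (sliceRight M f.ofConv x) =
      LinearMap.mul' k k (TensorProduct.map φ f.ofConv x) := fun x => by
    induction x with
    | zero => simp
    | add x y hx hy => simp only [map_add, hx, hy]
    | tmul m c => simp [mul_comm]
  exact this _

/-- Tested against functionals on `M`, the unit and associativity laws become those of the right
action on `M*`. -/
noncomputable instance actModule : Module (DualAlgebra k C) M where
  smul := act
  one_smul m := eq_of_forall_dual (k := k) fun φ => by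
    change φ (act (1 : DualAlgebra k C) m) = _
    rw [apply_act, dualAct_one]
  mul_smul f g m := eq_of_forall_dual (k := k) fun φ => by
    change φ (act (f * g) m) = φ (act f (act g m))
    rw [apply_act, dualAct_mul, apply_act, apply_act]
  smul_zero f := by change act f 0 = 0; simp [act]
  smul_add f m m' := by change act f (m + m') = act f m + act f m'; simp [act]
  add_smul f g m := eq_of_forall_dual (k := k) fun φ => by
    change φ (act (f + g) m) = φ (act f m + act g m)
    rw [map_add, apply_act, apply_act, apply_act]
    simp [dualAct, TensorProduct.map_add_right]
  zero_smul m := eq_of_forall_dual (k := k) fun φ => by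
    change φ (act (0 : DualAlgebra k C) m) = φ 0
    rw [apply_act]
    simp [dualAct]

theorem smul_eq (f : DualAlgebra k C) (m : M) : f • m = sliceRight M f.ofConv (coact m) := rfl

theorem apply_smul (φ : Module.Dual k M) (f : DualAlgebra k C) (m : M) :
    φ (f • m) = dualAct φ f m := apply_act φ f m

instance : IsScalarTower k (DualAlgebra k C) M where
  smul_assoc c f m := eq_of_forall_dual (k := k) fun φ => by
    rw [apply_smul, map_smul φ c (f • m), apply_smul]
    simp [dualAct, TensorProduct.map_smul_right]

/-- The coefficient map `m ↦ ∑ φ(m₀) m₁`. -/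
noncomputable def coeff (φ : Module.Dual k M) : M →ₗ[k] C := sliceLeft C φ ∘ₗ coact

theorem apply_coeff (φ : Module.Dual k M) (f : C →ₗ[k] k) (m : M) :
    f (coeff φ m) = φ (WithConv.toConv f • m) := apply_sliceLeft _ _ _

/-- The counit is the unit of `C*`. Thus `φ` can be recovered from its coefficient map. -/
theorem counit_coeff (φ : Module.Dual k M) (m : M) :
    Coalgebra.counit (R := k) (coeff (C := C) φ m) = φ m := by
  rw [apply_coeff, apply_smul]
  exact LinearMap.congr_fun (dualAct_one φ) m

/-- Comodule homomorphisms are the maps that commute with the action of `C*`. -/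
theorem mem_comoduleHom_iff {g : M →ₗ[k] N} :
    g ∈ comoduleHom k C M N ↔ ∀ (f : DualAlgebra k C) (m : M), g (f • m) = f • g m := by
  constructor
  · intro h f m
    rw [smul_eq, smul_eq, ← sliceRight_rTensor]
    exact congrArg _ (LinearMap.congr_fun h m).symm
  · intro h
    refine LinearMap.ext fun m => eq_of_sliceRight fun f => ?_
    simp only [LinearMap.comp_apply]
    rw [sliceRight_rTensor]
    exact (h (WithConv.toConv f) m).symm

theorem apply_smul_self (g : C →ₗ[k] k) (f : DualAlgebra k C) (c : C) :
    g (f • c) = (WithConv.toConv g * f).ofConv c := apply_smul (C := C) g f c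

theorem coeff_smul (φ : Module.Dual k M) (f : DualAlgebra k C) (m : M) :
    coeff (C := C) φ (f • m) = f • coeff (C := C) φ m :=
  eq_of_forall_dual (k := k) fun g => by
    rw [apply_coeff, apply_smul_self, apply_coeff, smul_smul]

/-- A comodule map `M → C` is the coefficient map of its composite with the counit. -/
theorem eq_coeff {g : M →ₗ[k] C} (h : g ∈ comoduleHom k C M C) :
    g = coeff (Coalgebra.counit ∘ₗ g) := by
  ext m
  refine eq_of_forall_dual (k := k) fun f => ?_
  have : (WithConv.toConv (Coalgebra.counit (R := k) (A := C)) : DualAlgebra k C) = 1 := by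
    ext; simp [LinearMap.convOne_def]
  rw [apply_coeff, LinearMap.comp_apply, mem_comoduleHom_iff.mp h, apply_smul_self, this, one_mul]

end Action

end RightComodule

/-! ### Descending chains in locally finite modules -/

section SimpleSubmodules

variable {k R N : Type*} [Field k] [Ring R] [Algebra k R]
  [AddCommGroup N] [Module k N] [Module R N] [IsScalarTower k R N]

/-- A nonzero submodule of a locally finite module contains a simple one. -/
theorem Submodule.exists_isSimpleModule_le
    (hN : ∀ x : N, Module.Finite k (Submodule.span R {x}))
    {Y : Submodule R N} (hY : Y ≠ ⊥) : ∃ S ≤ Y, IsSimpleModule R S := by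
  obtain ⟨y, hy, hy0⟩ := Submodule.exists_mem_ne_zero_of_ne_bot hY
  let Z := Submodule.span R {y}
  have hfin : Module.Finite k Z := hN y
  have : IsArtinian R Z := isArtinian_of_tower k inferInstance
  have : Nontrivial Z := ⟨⟨⟨y, Submodule.mem_span_singleton_self y⟩, 0, fun h =>
    hy0 (congrArg Subtype.val h)⟩⟩
  obtain ⟨S, hS⟩ := IsAtomic.exists_atom (Submodule R Z)
  rw [← isSimpleModule_iff_isAtom] at hS
  refine ⟨S.map Z.subtype, (Z.map_subtype_le S).trans ?_, ?_⟩
  · exact (Submodule.span_singleton_le_iff_mem _ _).mpr hy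
  · exact IsSimpleModule.congr (S.equivMapOfInjective _ Z.subtype_injective).symm

theorem Submodule.exists_eq_bot_of_antitone_of_iInf_eq_bot {V : Type*} [AddCommGroup V] [Module k V]
    [FiniteDimensional k V] {W : ℕ → Submodule k V} (hW : Antitone W) (h : ⨅ i, W i = ⊥) :
    ∃ n, W n = ⊥ := by
  obtain ⟨n, hn⟩ := monotone_stabilizes_iff_artinian.mpr
    (inferInstance : IsArtinian k V) ⟨fun i => OrderDual.toDual (W i), fun _ _ hij => hW hij⟩
  refine ⟨n, le_bot_iff.mp (h ▸ le_iInf fun i => ?_)⟩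
  rcases le_total n i with hi | hi
  · exact (show W n = W i from hn i hi).le
  · exact hW hi

/-- If `N` is a locally finite module whose simple submodules `S` all embed in a fixed
finite-dimensional module and have finite-dimensional `Hom(S, N)`, then every descending
sequence of submodules of `N` with zero intersection reaches zero. -/
theorem Submodule.exists_eq_bot_of_finiteDimensional_hom {E : Type*} [AddCommGroup E] [Module k E]
    [Module R E] [IsScalarTower k R E] [FiniteDimensional k E]
    (hN : ∀ x : N, Module.Finite k (Submodule.span R {x}))
    (hE : ∀ S : Submodule R N, IsSimpleModule R S → ∃ g : S →ₗ[R] E, Function.Injective g)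
    (hS : ∀ S : Submodule R N, IsSimpleModule R S → FiniteDimensional k (S →ₗ[R] N))
    {Z : ℕ → Submodule R N} (hZ : Antitone Z) (h : ⨅ i, Z i = ⊥) : ∃ n, Z n = ⊥ := by
  have : IsNoetherian R E := isNoetherian_of_tower k inferInstance
  let T := {S : Submodule R N // IsSimpleModule R S}
  -- The isotypic component in `E` records the isomorphism type of a simple module; there are
  -- finitely many because `E` is noetherian.
  let c : T → isotypicComponents R E := fun S =>
    ⟨isotypicComponent R E S.1, by
      obtain ⟨g, hg⟩ := hE S.1 S.2
      have := S.2
      let e := LinearEquiv.ofInjective g hg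
      exact ⟨LinearMap.range g, IsSimpleModule.congr e.symm, e.isotypicComponent_eq⟩⟩
  have hc : ∀ S S' : T, c S = c S' → Nonempty (S.1 ≃ₗ[R] S'.1) := by
    intro S S' hSS
    obtain ⟨g, hg⟩ := hE S.1 S.2
    let e := LinearEquiv.ofInjective g hg
    have := S.2
    have := S'.2
    have := IsSimpleModule.congr e.symm
    have hcomp : isotypicComponent R E S.1 = isotypicComponent R E S'.1 := congrArg Subtype.val hSS
    have hle : LinearMap.range g ≤ isotypicComponent R E S'.1 := by
      rw [← hcomp, e.isotypicComponent_eq]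
      exact Submodule.le_isotypicComponent _
    obtain ⟨e''⟩ := isIsotypicOfType_submodule_iff.mp (.isotypicComponent R E S'.1) _ hle
    exact ⟨e.trans e''⟩
  have hfin : ∀ S : T, ∃ n, ∀ g : S.1 →ₗ[R] N, LinearMap.range g ≤ Z n → g = 0 := by
    intro S
    have := hS S.1 S.2
    -- The maps with image in `Z i`; their intersection is zero because that of the `Z i` is.
    let W : ℕ → Submodule k (S.1 →ₗ[R] N) := fun i =>
      { carrier := {g | ∀ s, g s ∈ Z i}
        add_mem' := fun ha hb s => add_mem (ha s) (hb s)
        zero_mem' := fun s => zero_mem _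
        smul_mem' := fun a g hg s => ((Z i).restrictScalars k).smul_mem a (hg s) }
    obtain ⟨n, hn⟩ := Submodule.exists_eq_bot_of_antitone_of_iInf_eq_bot (W := W)
      (fun i j hij g hg s => hZ hij (hg s)) <| by
        refine eq_bot_iff.mpr fun g hg => ?_
        rw [Submodule.mem_bot]
        ext s
        rw [LinearMap.zero_apply, ← Submodule.mem_bot R, ← h, Submodule.mem_iInf]
        exact fun i => (Submodule.mem_iInf _).mp hg i s
    refine ⟨n, fun g hg => ?_⟩
    rw [← Submodule.mem_bot k, ← hn]
    exact fun s => hg ⟨s, rfl⟩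
  choose n hn using hfin
  have : Finite (Set.range c) := inferInstance
  have hrep : ∀ x : Set.range c, ∃ S, c S = x := fun x => x.2
  choose rep hrep using hrep
  -- One stage `b` beyond the vanishing stages of all representatives: a simple submodule of `Z b`
  -- would give a nonzero map from its representative into `Z b`.
  obtain ⟨b, hb⟩ := (Set.finite_range (n ∘ rep)).bddAbove
  refine ⟨b, by_contra fun hb0 => ?_⟩
  obtain ⟨S, hSb, hSs⟩ := Submodule.exists_isSimpleModule_le hN hb0
  obtain ⟨e⟩ := hc (rep ⟨_, ⟨S, hSs⟩, rfl⟩) ⟨S, hSs⟩ (hrep _)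
  have hz := hn _ (S.subtype ∘ₗ e.toLinearMap) <| by
    rintro _ ⟨s, rfl⟩
    exact hZ (hb ⟨_, rfl⟩) (hSb (e s).2)
  have := IsSimpleModule.nontrivial R S
  obtain ⟨x, hx⟩ := exists_ne (0 : S)
  apply hx
  have := LinearMap.congr_fun hz (e.symm x)
  simpa using this

end SimpleSubmodules

namespace RightComodule

/-! ### Subcomodules as `C*`-submodules; local finiteness -/

section Subcomodules

variable {k C M N : Type*} [Field k] [AddCommGroup C] [Module k C] [Coalgebra k C]
  [AddCommGroup M] [Module k M] [RightComodule k C M]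
  [AddCommGroup N] [Module k N] [RightComodule k C N]

/-- Subcomodules are the same as `C*`-submodules. -/
noncomputable def subcomoduleEquiv : Subcomodule k C M ≃o Submodule (DualAlgebra k C) M where
  toFun X := { X.carrier with
    smul_mem' := fun f _ hx => mem_range_rTensor_subtype_iff.mp (X.coact_mem _ hx) f.ofConv }
  invFun Y := ⟨Y.restrictScalars k, fun _ hx =>
    mem_range_rTensor_subtype_iff.mpr fun f => Y.smul_mem (WithConv.toConv f) hx⟩
  left_inv _ := rfl
  right_inv _ := rfl
  map_rel_iff' := Iff.rfl

@[simp]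
theorem mem_subcomoduleEquiv {X : Subcomodule k C M} {m : M} :
    m ∈ subcomoduleEquiv X ↔ m ∈ X.carrier := Iff.rfl

theorem mkQ_smul (X : Subcomodule k C M) (f : DualAlgebra k C) (m : M) :
    X.carrier.mkQ (f • m) = f • X.carrier.mkQ m :=
  (mem_comoduleHom_iff (g := X.carrier.mkQ)).mp (Submodule.liftQ_mkQ _ _ X.le_ker) f m

theorem isSimple_iff : IsSimple k C M ↔ IsSimpleModule (DualAlgebra k C) M := by
  rw [isSimpleModule_iff, isSimpleOrder_iff]
  refine and_congr (Submodule.nontrivial_iff _).symm ?_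
  rw [subcomoduleEquiv.symm.surjective.forall]
  refine forall_congr' fun Y => or_congr ?_ ?_
  · exact Submodule.restrictScalars_eq_bot_iff k (DualAlgebra k C) M
  · exact Submodule.restrictScalars_eq_top_iff k (DualAlgebra k C) M

/-- The comodule structure on a `C*`-submodule. -/
@[reducible]
noncomputable def ofSubmodule (Y : Submodule (DualAlgebra k C) M) :
    RightComodule k C (Y.restrictScalars k) :=
  let ι := (Y.restrictScalars k).subtype
  have hp := (exists_retraction (Y.restrictScalars k)).choose_spec
  let p := (exists_retraction (Y.restrictScalars k)).choose
  let r := p.rTensor C ∘ₗ coact ∘ₗ ι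
  have hpi : p ∘ₗ ι = LinearMap.id := LinearMap.ext hp
  -- Compressing the coaction by the retraction `p` loses nothing, since `Y` is stable under all
  -- slices.
  have hr : coact ∘ₗ ι = ι.rTensor C ∘ₗ r := by
    ext y
    simp only [r, LinearMap.comp_apply]
    rw [← LinearMap.comp_apply (ι.rTensor C), ← LinearMap.rTensor_comp]
    exact (rTensor_comp_eq_self _ (fun m hm => congrArg Subtype.val (hp ⟨m, hm⟩))
      fun f => Y.smul_mem (WithConv.toConv f) y.2).symm
  { coact := r
    coassoc := by
      have e1 : (p.rTensor (C ⊗[k] C)) ∘ₗ (TensorProduct.assoc k M C C).toLinearMap ∘ₗ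
          (ι.rTensor C).rTensor C =
          (TensorProduct.assoc k (Y.restrictScalars k) C C).toLinearMap := by
        ext y c d
        simp [show p (ι y) = y from hp y]
      have e2 : (Coalgebra.comul (R := k) (A := C)).lTensor (Y.restrictScalars k) ∘ₗ p.rTensor C =
          p.rTensor (C ⊗[k] C) ∘ₗ (Coalgebra.comul (R := k) (A := C)).lTensor M := by
        ext; simp
      calc _ = p.rTensor (C ⊗[k] C) ∘ₗ (TensorProduct.assoc k M C C).toLinearMap ∘ₗ
            (ι.rTensor C ∘ₗ r).rTensor C ∘ₗ r := by
              rw [← e1, LinearMap.rTensor_comp _ _ r]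
              rfl
        _ = p.rTensor (C ⊗[k] C) ∘ₗ ((TensorProduct.assoc k M C C).toLinearMap ∘ₗ
            coact.rTensor C ∘ₗ coact) ∘ₗ ι := by
              rw [← hr, LinearMap.rTensor_comp, LinearMap.comp_assoc, ← hr]
              rfl
        _ = _ := by
              rw [coassoc, LinearMap.comp_assoc, ← LinearMap.comp_assoc, ← e2]
              rfl
    counit_coact := by
      have e : (TensorProduct.rid k (Y.restrictScalars k)).toLinearMap ∘ₗ
          (Coalgebra.counit (R := k) (A := C)).lTensor _ ∘ₗ p.rTensor C =
          p ∘ₗ (TensorProduct.rid k M).toLinearMap ∘ₗ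
            (Coalgebra.counit (R := k) (A := C)).lTensor M := by
        ext; simp
      have h1 := congrArg (· ∘ₗ coact ∘ₗ ι) e
      have h2 := congrArg (p ∘ₗ · ∘ₗ ι) (counit_coact (k := k) (C := C) (M := M))
      exact h1.trans (h2.trans hpi) }

theorem ofSubmodule_smul (Y : Submodule (DualAlgebra k C) M) (f : DualAlgebra k C) (y : Y) :
    letI := ofSubmodule Y
    (f • (show Y.restrictScalars k from y) : Y.restrictScalars k) = f • y := by
  let := ofSubmodule Y
  apply Subtype.ext
  have hp := (exists_retraction (Y.restrictScalars k)).choose_spec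
  have : (f • (show Y.restrictScalars k from y) : Y.restrictScalars k) =
      (exists_retraction (Y.restrictScalars k)).choose (f • (y : M)) := by
    rw [smul_eq, smul_eq]
    exact sliceRight_rTensor _ _ _
  rw [this]
  exact congrArg Subtype.val (hp ⟨f • (y : M), Y.smul_mem f y.2⟩)

/-- Comodules are locally finite. -/
theorem finite_span_singleton (m : M) :
    Module.Finite k (Submodule.span (DualAlgebra k C) {m}) := by
  obtain ⟨s, hs⟩ := TensorProduct.exists_finset (R := k) (coact m : M ⊗[k] C)
  -- Every `f • m` is a combination of the left tensor factors in one expression of `ρ(m)`.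
  let W : Submodule k M := Submodule.span k (Prod.fst '' (s : Set (M × C)))
  have hW : Module.Finite k W := Module.Finite.span_of_finite k (s.finite_toSet.image _)
  have : (Submodule.span (DualAlgebra k C) {m}).restrictScalars k ≤ W := by
    intro x hx
    obtain ⟨f, rfl⟩ := Submodule.mem_span_singleton.mp (Submodule.restrictScalars_mem k _ _ |>.mp hx)
    rw [smul_eq, hs, map_sum]
    refine sum_mem fun i hi => ?_
    rw [sliceRight_tmul]
    exact W.smul_mem _ (Submodule.subset_span ⟨i, hi, rfl⟩)
  exact Submodule.finiteDimensional_of_le this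

theorem finite_of_isSimpleModule [IsSimpleModule (DualAlgebra k C) M] : Module.Finite k M := by
  have := IsSimpleModule.nontrivial (DualAlgebra k C) M
  obtain ⟨m, hm⟩ := exists_ne (0 : M)
  have := finite_span_singleton (k := k) (C := C) m
  rw [IsSimpleModule.span_singleton_eq_top (DualAlgebra k C) hm] at this
  exact Module.Finite.equiv
    ((Submodule.topEquiv (R := DualAlgebra k C) (M := M)).restrictScalars k)

end Subcomodules

/-! ### Simple comodules and the coradical -/

section Coradical

variable {k C M : Type*} [Field k] [AddCommGroup C] [Module k C] [Coalgebra k C]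
  [AddCommGroup M] [Module k M] [RightComodule k C M]

theorem isSubcoalgebra_iff {D : Submodule k C} : IsSubcoalgebra k D ↔
    ∀ x ∈ D, (∀ f : DualAlgebra k C, f • x ∈ D) ∧ ∀ φ : Module.Dual k C, coeff φ x ∈ D := by
  refine forall₂_congr fun x _ => ?_
  rw [mem_range_map_subtype_iff]
  exact and_congr_left' ⟨fun h f => h f.ofConv, fun h f => h (WithConv.toConv f)⟩

/-- The coefficient map as a map of `C*`-modules. -/
noncomputable def coeffHom (φ : Module.Dual k M) : M →ₗ[DualAlgebra k C] C where
  toFun := coeff φ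
  map_add' := map_add _
  map_smul' := coeff_smul φ

/-- Any `C*`-linear map from a submodule of `M` to `C` is the restriction of a coefficient map. -/
theorem exists_eq_coeff {Y : Submodule (DualAlgebra k C) M} (h : Y →ₗ[DualAlgebra k C] C) :
    ∃ φ : Module.Dual k M, ∀ y : Y, h y = coeff φ (y : M) := by
  obtain ⟨p, hp⟩ := exists_retraction (Y.restrictScalars k)
  -- A map into `C` is governed by its composite with the counit; the retraction extends that
  -- functional from `Y` to `M`.
  let φ : Module.Dual k M := Coalgebra.counit ∘ₗ h.restrictScalars k ∘ₗ p
  refine ⟨φ, fun y => eq_of_forall_dual (k := k) fun f => ?_⟩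
  have h1 : φ (WithConv.toConv f • (y : M)) =
      Coalgebra.counit (R := k) (h (WithConv.toConv f • y)) :=
    congrArg (fun z => Coalgebra.counit (R := k) (h z)) (hp (WithConv.toConv f • y))
  have h2 : (WithConv.toConv (Coalgebra.counit (R := k) (A := C)) : DualAlgebra k C) = 1 := by
    ext; simp [LinearMap.convOne_def]
  rw [apply_coeff, h1, map_smul, apply_smul_self, h2, one_mul]

theorem coeff_counit (c : C) : coeff (C := C) (Coalgebra.counit (R := k) (A := C)) c = c := by
  have := eq_coeff (k := k) (C := C) (M := C) (g := LinearMap.id)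
    (mem_comoduleHom_iff.mpr fun _ _ => rfl)
  exact (LinearMap.congr_fun this c).symm

/-- The composite is again a comodule map into `C`, hence a coefficient map. -/
theorem coeff_coeff (φ : Module.Dual k C) (ψ : Module.Dual k M) :
    ∃ χ : Module.Dual k M, ∀ m, coeff φ (coeff (C := C) ψ m) = coeff (C := C) χ m := by
  have := eq_coeff (k := k) (C := C) (g := coeff φ ∘ₗ coeff ψ)
    (mem_comoduleHom_iff.mpr fun f m => by
      rw [LinearMap.comp_apply, coeff_smul, coeff_smul, LinearMap.comp_apply])
  exact ⟨_, LinearMap.congr_fun this⟩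

/-- The subcoalgebra generated by a simple right coideal is simple. -/
theorem isSimpleSubcoalgebra_iSup_map (J : Submodule (DualAlgebra k C) C)
    [IsSimpleModule (DualAlgebra k C) J] :
    IsSimpleSubcoalgebra k
      ((⨆ φ : Module.Dual k C, J.map (coeffHom φ)).restrictScalars k) := by
  set D := ⨆ φ : Module.Dual k C, J.map (coeffHom φ) with hD
  have hJD : J ≤ D := fun x hx =>
    Submodule.mem_iSup_of_mem Coalgebra.counit ⟨x, hx, coeff_counit x⟩
  have hJ : J ≠ ⊥ := (Submodule.nontrivial_iff_ne_bot).mp (IsSimpleModule.nontrivial (DualAlgebra k C) J)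
  have hDJ : D ≤ isotypicComponent (DualAlgebra k C) C J :=
    iSup_le fun φ => J.map_le_isotypicComponent _
  refine ⟨isSubcoalgebra_iff.mpr fun x hx => ⟨fun f => D.smul_mem f hx, fun φ => ?_⟩, ?_, ?_⟩
  · suffices D ≤ D.comap (coeffHom φ) from this hx
    refine iSup_le fun ψ => ?_
    rintro _ ⟨y, hy, rfl⟩
    obtain ⟨χ, hχ⟩ := coeff_coeff φ ψ
    exact Submodule.mem_iSup_of_mem χ ⟨y, hy, (hχ y).symm⟩
  · rw [Ne, Submodule.restrictScalars_eq_bot_iff]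
    exact fun h => hJ (le_bot_iff.mp (h ▸ hJD))
  · intro E hED hE
    rw [or_iff_not_imp_left]
    intro hE0
    have hE' := isSubcoalgebra_iff.mp hE
    let E' : Submodule (DualAlgebra k C) C :=
      { E with smul_mem' := fun f x hx => (hE' x hx).1 f }
    have hE'0 : E' ≠ ⊥ := fun h => hE0 <| by
      have : E'.restrictScalars k = ⊥ := by rw [h]; rfl
      exact this
    -- `D` is isotypic of type `J`, so a simple submodule of `E` is isomorphic to `J`. The
    -- isomorphism extends to a coefficient map, which preserves `E`; so `J`, and with it `D`, lies
    -- in `E`.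
    obtain ⟨J', hJ'E, hJ'⟩ :=
      Submodule.exists_isSimpleModule_le (k := k) (finite_span_singleton (C := C)) hE'0
    obtain ⟨e⟩ := isIsotypicOfType_submodule_iff.mp
      (.isotypicComponent (DualAlgebra k C) C J) J' (hJ'E.trans (LE.le.trans hED hDJ))
    obtain ⟨φ, hφ⟩ := exists_eq_coeff (J.subtype ∘ₗ e.toLinearMap)
    have hJE : ∀ x ∈ J, x ∈ E := fun x hx => by
      have := hφ (e.symm ⟨x, hx⟩)
      simp only [LinearMap.comp_apply, LinearEquiv.coe_coe, LinearEquiv.apply_symm_apply,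
        Submodule.subtype_apply] at this
      rw [this]
      exact (hE' _ (hJ'E (e.symm ⟨x, hx⟩).2)).2 φ
    refine le_antisymm hED ?_
    suffices D ≤ E' from this
    refine iSup_le fun ψ => ?_
    rintro _ ⟨y, hy, rfl⟩
    exact (hE' y (hJE y hy)).2 ψ

variable (k C) in
/-- The coradical as a `C*`-submodule of `C`. -/
noncomputable def coradicalSubmodule : Submodule (DualAlgebra k C) C :=
  { coradical k C with
    smul_mem' := fun f x hx => by
      suffices coradical k C ≤ (coradical k C).comap (Algebra.lsmul k k C f) from this hx
      exact sSup_le fun D hD y hy =>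
        (le_sSup hD : D ≤ coradical k C) ((isSubcoalgebra_iff.mp hD.1 y hy).1 f) }

theorem le_coradicalSubmodule (J : Submodule (DualAlgebra k C) C)
    [IsSimpleModule (DualAlgebra k C) J] : J ≤ coradicalSubmodule k C := fun x hx =>
  (le_sSup (isSimpleSubcoalgebra_iSup_map J) : _ ≤ coradical k C)
    (Submodule.mem_iSup_of_mem Coalgebra.counit ⟨x, hx, coeff_counit x⟩)

/-- Every simple comodule embeds in the coradical. -/
theorem exists_injective_coradicalSubmodule (S : Submodule (DualAlgebra k C) M)
    (hS : IsSimpleModule (DualAlgebra k C) S) :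
    ∃ g : S →ₗ[DualAlgebra k C] coradicalSubmodule k C, Function.Injective g := by
  have := IsSimpleModule.nontrivial (DualAlgebra k C) S
  obtain ⟨s, hs⟩ := exists_ne (0 : S)
  obtain ⟨φ, hφ⟩ : ∃ φ : Module.Dual k M, φ s ≠ 0 := by
    by_contra! h
    exact hs (Subtype.ext ((Module.forall_dual_apply_eq_zero_iff k _).mp h))
  let g := (coeffHom (C := C) φ) ∘ₗ S.subtype
  -- Schur's lemma: the map is nonzero because the counit recovers `φ s ≠ 0` from it.
  have hg : Function.Injective g := by
    refine (LinearMap.injective_or_eq_zero (R := DualAlgebra k C) (M := S) (N := C)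
      g).resolve_right fun h => hφ ?_
    have : coeff (C := C) φ (s : M) = 0 := LinearMap.congr_fun h s
    rw [← counit_coeff (C := C), this, map_zero]
  have : IsSimpleModule (DualAlgebra k C) (LinearMap.range g) :=
    IsSimpleModule.congr (N := S) (LinearEquiv.ofInjective g hg).symm
  exact ⟨g.codRestrict _ fun x => le_coradicalSubmodule (LinearMap.range g) ⟨x, rfl⟩,
    fun x y h => hg (congrArg Subtype.val h)⟩

end Coradical

/-! ### The four implications -/

section Implications

universe u v w

variable {k : Type u} {C : Type v} {M : Type w} [Field k] [AddCommGroup C] [Module k C]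
  [Coalgebra k C] [AddCommGroup M] [Module k M] [RightComodule k C M]

theorem IsQuasiFinite.finiteDimensional_hom (h : IsQuasiFinite k C M)
    (S : Submodule (DualAlgebra k C) M) (hS : IsSimpleModule (DualAlgebra k C) S) :
    FiniteDimensional k (S →ₗ[DualAlgebra k C] M) := by
  let := ofSubmodule S
  let e : S.restrictScalars k ≃ₗ[DualAlgebra k C] S :=
    { LinearEquiv.refl k (S.restrictScalars k) with
      map_smul' := fun f y => ofSubmodule_smul S f y }
  have hs : IsSimple k C (S.restrictScalars k) :=
    isSimple_iff.mpr (IsSimpleModule.congr (N := S) e)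
  have := h (S.restrictScalars k) hs
  let F : (S →ₗ[DualAlgebra k C] M) →ₗ[k] comoduleHom k C (S.restrictScalars k) M :=
    { toFun := fun g => ⟨g.restrictScalars k, mem_comoduleHom_iff.mpr fun f y =>
        (congrArg g (ofSubmodule_smul S f y)).trans (map_smul g f _)⟩
      map_add' := fun _ _ => rfl
      map_smul' := fun _ _ => rfl }
  exact FiniteDimensional.of_injective F fun g g' hg =>
    LinearMap.ext fun s => LinearMap.congr_fun (congrArg Subtype.val hg) s

theorem IsQuasiFinite.exists_eq_bot (hC : IsAlmostConnected k C) (h : IsQuasiFinite k C M)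
    {Z : ℕ → Submodule (DualAlgebra k C) M} (hZ : Antitone Z) (h0 : ⨅ i, Z i = ⊥) :
    ∃ n, Z n = ⊥ := by
  have : FiniteDimensional k (coradicalSubmodule k C) := hC
  exact Submodule.exists_eq_bot_of_finiteDimensional_hom (k := k) (E := coradicalSubmodule k C)
    (finite_span_singleton (C := C)) exists_injective_coradicalSubmodule
    h.finiteDimensional_hom hZ h0

theorem isArtinianComodule_iff :
    IsArtinianComodule k C M ↔ IsArtinian (DualAlgebra k C) M :=
  ⟨fun h => have : WellFoundedLT (Subcomodule k C M) := h
    subcomoduleEquiv.symm.strictMono.wellFoundedLT,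
  fun _ => subcomoduleEquiv.strictMono.wellFoundedLT⟩

theorem IsStrictlyQuasiFinite.isArtinianComodule (hC : IsAlmostConnected k C)
    (h : IsStrictlyQuasiFinite k C M) : IsArtinianComodule k C M := by
  rw [isArtinianComodule_iff, ← monotone_stabilizes_iff_artinian]
  intro Y
  let X := subcomoduleEquiv.symm (⨅ i, OrderDual.ofDual (Y i))
  have hX : ∀ x : M, x ∈ X.carrier ↔ ∀ i, x ∈ OrderDual.ofDual (Y i) := fun x =>
    Submodule.mem_iInf _
  let q : M →ₗ[DualAlgebra k C] M ⧸ X.carrier :=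
    { X.carrier.mkQ with map_smul' := mkQ_smul X }
  have hq : ∀ m, q m = 0 ↔ m ∈ X.carrier := fun m => Submodule.Quotient.mk_eq_zero _
  -- `X` lies in every `Y i`, so each term is the full preimage of its image in `M ⧸ X`.
  have hmem : ∀ i m, q m ∈ (OrderDual.ofDual (Y i)).map q → m ∈ OrderDual.ofDual (Y i) := by
    rintro i m ⟨y, hy, hym⟩
    have := (hX _).mp ((hq (y - m)).mp (by rw [map_sub, hym, sub_self])) i
    exact (Submodule.sub_mem_iff_right _ hy).mp this
  obtain ⟨n, hn⟩ := (h X).exists_eq_bot hC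
    (Z := fun i => (OrderDual.ofDual (Y i)).map q)
    (fun i j hij => Submodule.map_mono (Y.monotone hij)) <| by
      refine eq_bot_iff.mpr fun z hz => ?_
      obtain ⟨m, rfl⟩ : ∃ m, q m = z := X.carrier.mkQ_surjective z
      exact (hq m).mpr ((hX m).mpr fun i => hmem i m ((Submodule.mem_iInf _).mp hz i))
  refine ⟨n, fun m hm => le_antisymm (Y.monotone hm) ?_⟩
  intro x hx
  have : q x = 0 := by
    rw [← Submodule.mem_bot (DualAlgebra k C), ← hn]
    exact ⟨x, hx, rfl⟩
  exact (hX x).mp ((hq x).mp this) m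

theorem proj_mem_comoduleHom (n : ℕ) (i : Fin n) :
    (LinearMap.proj i : (Fin n → M) →ₗ[k] M) ∈ comoduleHom k C (Fin n → M) M := by
  refine LinearMap.pi_ext' fun j => ?_
  change (coact ∘ₗ LinearMap.proj i) ∘ₗ LinearMap.single k (fun _ => M) j =
    (LinearMap.proj i).rTensor C ∘ₗ piCoact k C M n ∘ₗ LinearMap.single k (fun _ => M) j
  rw [piCoact_comp_single, ← LinearMap.comp_assoc, ← LinearMap.rTensor_comp, LinearMap.comp_assoc]
  rcases eq_or_ne i j with rfl | hij
  · rw [LinearMap.proj_comp_single_same, LinearMap.rTensor_id]; rfl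
  · rw [LinearMap.proj_comp_single_ne _ _ _ _ hij]; simp

/-- Projections are comodule maps. The action is written `act` to keep it apart from the pointwise
scalar action on functions. -/
theorem pi_smul_apply (n : ℕ) (f : DualAlgebra k C) (x : Fin n → M) (i : Fin n) :
    act f x i = f • x i :=
  mem_comoduleHom_iff.mp (proj_mem_comoduleHom n i) f x

theorem IsCoNoetherian.isStrictlyQuasiFinite (h : IsCoNoetherian k C M) :
    IsStrictlyQuasiFinite k C M := by
  intro X S _ _ _ hS
  obtain ⟨n, ι, hι, hinj⟩ := h X
  have := isSimple_iff.mp hS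
  have : Module.Finite k S := finite_of_isSimpleModule (C := C)
  -- Injective because the counit composites determine each coordinate of `ι ∘ g`; the target is
  -- finite-dimensional because the simple `S` is.
  let F : comoduleHom k C S (M ⧸ X.carrier) →ₗ[k] (Fin n → Module.Dual k S) :=
    { toFun := fun g i => Coalgebra.counit ∘ₗ LinearMap.proj i ∘ₗ ι ∘ₗ g.1
      map_add' := fun g g' => by ext; simp
      map_smul' := fun c g => by ext; simp }
  refine FiniteDimensional.of_injective F fun g g' hg => Subtype.ext <| LinearMap.ext fun s =>
    hinj <| funext fun i => ?_
  have key : ∀ g ∈ comoduleHom k C S (M ⧸ X.carrier), ∀ s,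
      ι (g s) i = coeff (Coalgebra.counit ∘ₗ LinearMap.proj i ∘ₗ ι ∘ₗ g) s := by
    intro g hg
    refine LinearMap.congr_fun (eq_coeff (k := k) (C := C) (g := LinearMap.proj i ∘ₗ ι ∘ₗ g) ?_)
    refine mem_comoduleHom_iff.mpr fun f s => ?_
    simp only [LinearMap.comp_apply]
    rw [mem_comoduleHom_iff.mp hg, mem_comoduleHom_iff.mp hι,
      mem_comoduleHom_iff.mp (proj_mem_comoduleHom n i)]
  rw [key g.1 g.2, key g'.1 g'.2]
  exact congrArg (fun φ => coeff (C := C) φ s) (congrFun hg i)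

theorem op_smul_apply (φ : Module.Dual k M) (f : (DualAlgebra k C)ᵐᵒᵖ) (m : M) :
    (f • φ) m = φ (f.unop • m) := (apply_smul φ f.unop m).symm

/-- The subspace of `M` on which all functionals in `P` vanish, as a `C*`-submodule. -/
def orthogonal (P : Submodule (DualAlgebra k C)ᵐᵒᵖ (Module.Dual k M)) :
    Submodule (DualAlgebra k C) M where
  carrier := {m | ∀ φ ∈ P, φ m = 0}
  add_mem' ha hb φ hφ := by rw [map_add, ha φ hφ, hb φ hφ, add_zero]
  zero_mem' φ _ := map_zero φ
  smul_mem' f m hm φ hφ := by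
    rw [← MulOpposite.unop_op f, ← op_smul_apply]
    exact hm _ (P.smul_mem _ hφ)

/-- The functionals vanishing on a `C*`-submodule `Y`. -/
def annihilator (Y : Submodule (DualAlgebra k C) M) :
    Submodule (DualAlgebra k C)ᵐᵒᵖ (Module.Dual k M) where
  carrier := {φ | ∀ m ∈ Y, φ m = 0}
  add_mem' ha hb m hm := by rw [LinearMap.add_apply, ha m hm, hb m hm, add_zero]
  zero_mem' _ _ := rfl
  smul_mem' f φ hφ m hm := by
    rw [op_smul_apply]
    exact hφ _ (Y.smul_mem _ hm)

theorem orthogonal_annihilator (Y : Submodule (DualAlgebra k C) M) :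
    orthogonal (annihilator Y) = Y := by
  refine le_antisymm (fun m hm => ?_) fun m hm φ hφ => hφ m hm
  rw [← Submodule.restrictScalars_mem k, ← Submodule.Quotient.mk_eq_zero,
    ← Module.forall_dual_apply_eq_zero_iff k]
  intro φ
  refine hm (φ ∘ₗ (Y.restrictScalars k).mkQ) fun y hy => ?_
  have : (Y.restrictScalars k).mkQ y = 0 := (Submodule.Quotient.mk_eq_zero _).mpr hy
  rw [LinearMap.comp_apply, this, map_zero]

/-- The common kernel of the coefficient maps of a generating family. -/
theorem mem_orthogonal_span_range_iff {n : ℕ} (φ : Fin n → Module.Dual k M) {m : M} :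
    m ∈ orthogonal (Submodule.span (DualAlgebra k C)ᵐᵒᵖ (Set.range φ)) ↔
      LinearMap.pi (fun i => coeff (C := C) (φ i)) m = 0 := by
  constructor
  · intro hm
    refine funext fun i => eq_of_forall_dual (k := k) fun f => ?_
    change f (coeff (φ i) m) = f 0
    rw [apply_coeff, map_zero]
    exact Submodule.smul_mem _ (WithConv.toConv f) hm (φ i) (Submodule.subset_span ⟨i, rfl⟩)
  · intro hm ψ hψ
    induction hψ using Submodule.span_induction generalizing m with
    | mem ψ hψ =>
      obtain ⟨i, rfl⟩ := hψ
      rw [← counit_coeff (C := C), show coeff (C := C) (φ i) m = 0 from congrFun hm i, map_zero]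
    | zero => rfl
    | add ψ ψ' _ _ h h' => rw [LinearMap.add_apply, h hm, h' hm, add_zero]
    | smul f ψ _ h =>
      rw [op_smul_apply]
      refine h (funext fun i => ?_)
      change coeff (φ i) (f.unop • m) = 0
      rw [coeff_smul, show coeff (C := C) (φ i) m = 0 from congrFun hm i, smul_zero]

/-- A functional killing the common kernel of the coefficient maps of the generators `φᵢ` factors
through `M → Cⁿ` as some `g`. The components of `g` lie in `C*` and are the coefficients expressing
the functional in the `φᵢ`. -/
theorem annihilator_orthogonal {P : Submodule (DualAlgebra k C)ᵐᵒᵖ (Module.Dual k M)}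
    (hP : P.FG) : annihilator (orthogonal P) = P := by
  refine le_antisymm (fun ψ hψ => ?_) fun φ hφ m hm => hm φ hφ
  obtain ⟨n, φ, rfl⟩ := Submodule.fg_iff_exists_fin_generating_family.mp hP
  have hker : LinearMap.ker (LinearMap.pi (fun i => coeff (C := C) (φ i))) ≤ LinearMap.ker ψ :=
    fun m hm => hψ m ((mem_orthogonal_span_range_iff φ).mpr hm)
  obtain ⟨g, hg⟩ : ∃ g : (Fin n → C) →ₗ[k] k,
      g ∘ₗ LinearMap.pi (fun i => coeff (C := C) (φ i)) = ψ := by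
    have : ψ ∈ (LinearMap.ker (LinearMap.pi fun i => coeff (C := C) (φ i))).dualAnnihilator :=
      (Submodule.mem_dualAnnihilator ψ).mpr hker
    rwa [← LinearMap.range_dualMap_eq_dualAnnihilator_ker] at this
  have : ψ = ∑ i, MulOpposite.op
      (WithConv.toConv (g ∘ₗ LinearMap.single k (fun _ => C) i)) • φ i := by
    ext m
    rw [← hg, LinearMap.comp_apply, LinearMap.sum_apply,
      ← Finset.univ_sum_single (LinearMap.pi (fun i => coeff (C := C) (φ i)) m), map_sum]
    refine Finset.sum_congr rfl fun i _ => ?_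
    rw [op_smul_apply, MulOpposite.unop_op, ← apply_coeff]
    rfl
  rw [this]
  exact sum_mem fun i _ => Submodule.smul_mem _ _ (Submodule.subset_span ⟨i, rfl⟩)

/-- The ascending chain condition need only be checked on finitely generated submodules, where the
double annihilator makes `orthogonal` injective and so strictly order-reversing. -/
theorem IsArtinianComodule.isNoetherian_dual (h : IsArtinianComodule k C M) :
    IsNoetherian (DualAlgebra k C)ᵐᵒᵖ (Module.Dual k M) := by
  have := isArtinianComodule_iff.mp h
  rw [isNoetherian_iff_fg_wellFounded]
  have hanti : StrictAnti fun P : {P : Submodule (DualAlgebra k C)ᵐᵒᵖ (Module.Dual k M) // P.FG} =>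
      orthogonal P.1 := by
    refine Antitone.strictAnti_of_injective (fun P Q hPQ m hm φ hφ => hm φ (hPQ hφ)) ?_
    intro P Q hPQ
    rw [Subtype.ext_iff, ← annihilator_orthogonal P.2, ← annihilator_orthogonal Q.2]
    exact congrArg annihilator hPQ
  exact hanti.wellFoundedGT

/-- Finitely many generators of the annihilator of `X` give coefficient maps with common kernel
exactly `X`. -/
theorem isCoNoetherian_of_isNoetherian_dual
    (h : IsNoetherian (DualAlgebra k C)ᵐᵒᵖ (Module.Dual k M)) : IsCoNoetherian k C M := by
  intro X
  obtain ⟨n, φ, hφ⟩ := Submodule.fg_iff_exists_fin_generating_family.mp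
    (h.noetherian (annihilator (subcomoduleEquiv X)))
  let F := LinearMap.pi (fun i => coeff (C := C) (φ i))
  have hker : ∀ m, F m = 0 ↔ m ∈ X.carrier := fun m => by
    rw [← mem_orthogonal_span_range_iff, hφ, orthogonal_annihilator, mem_subcomoduleEquiv]
  refine ⟨n, X.carrier.liftQ F fun m hm => (hker m).mpr hm, mem_comoduleHom_iff.mpr ?_, ?_⟩
  · intro f m
    obtain ⟨m, rfl⟩ := X.carrier.mkQ_surjective m
    rw [← mkQ_smul]
    refine funext fun i => ?_
    exact (coeff_smul (φ i) f m).trans (pi_smul_apply n f (F m) i).symm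
  · rw [← LinearMap.ker_eq_bot]
    exact Submodule.ker_liftQ_eq_bot _ _ _ fun m hm => (hker m).mp hm

end Implications

end RightComodule

theorem mainTheorem6 {k C M : Type*} [Field k] [AddCommGroup C] [Module k C] [Coalgebra k C]
    (hC : IsAlmostConnected k C) [AddCommGroup M] [Module k M] [RightComodule k C M] :
    List.TFAE [
      RightComodule.IsStrictlyQuasiFinite k C M,
      RightComodule.IsCoNoetherian k C M,
      IsNoetherian (RightComodule.DualAlgebra k C)ᵐᵒᵖ (Module.Dual k M),
      RightComodule.IsArtinianComodule k C M] := by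
  tfae_have 1 → 4 := fun h => h.isArtinianComodule hC
  tfae_have 4 → 3 := fun h => h.isNoetherian_dual
  tfae_have 3 → 2 := RightComodule.isCoNoetherian_of_isNoetherian_dual
  tfae_have 2 → 1 := fun h => h.isStrictlyQuasiFinite
  tfae_finish
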